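/- There is an absolute constant $C>0$ such that the following holds. Let $k\ge 1$ be an integer, let $\epsilon,\sigma>0$ and $\delta\in(0,1)$, and let $m$ be any integer with $$m\;\ge\; C\,\bigl(k^3+k^2\log(1/\delta)\bigr)\,\exp\bigl(C(\sigma/\epsilon)^{2/3}\bigr).$$ Then there is an algorithm, i.e. a measurable map $T$ from $\mathbb{R}^m$ to the finite subsets of $\mathbb{R}$ (depending on $k,\epsilon,\sigma,\delta,m$ only), such that for all pairwise distinct $\mu_1,\dots,\mu_k\in\epsilon\mathbb{Z}$, if $X_1,\dots,X_m$ are independent samples from the uniform Gaussian mixture $\mathcal{M}=\frac1k\sum_{i=1}^k\mathcal{N}(\mu_i,\sigma^2)$, then $$\Pr\bigl[T(X_1,\dots,X_m)=\{\mu_1,\dots,\mu_k\}\bigr]\ge 1-\delta .$$ In particular, for every fixed $\delta$, and even for $\delta=e^{-k}$, $k^3\exp(O((\sigma/\epsilon)^{2/3}))$ samples suffice to identify the means exactly with probability at least $1-\delta$ (when $\sigma/\epsilon$ tends to $0$, the bound is read as $O(k^3)$). -/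

import Mathlib

open MeasureTheory ProbabilityTheory
open scoped NNReal ENNReal

noncomputable section

namespace GaussianMixture

/-- The uniform mixture `(1/k) ∑ᵢ N(μᵢ, σ²)` of `k` univariate Gaussians with shared standard
deviation `σ`, as a measure on `ℝ`. -/
def mixture {k : ℕ} (μ : Fin k → ℝ) (σ : ℝ) : Measure ℝ :=
  (k : ℝ≥0∞)⁻¹ • ∑ i : Fin k, gaussianReal (μ i) (Real.toNNReal (σ ^ 2))

instance isProbabilityMeasure_mixture {k : ℕ} [NeZero k] (μ : Fin k → ℝ) (σ : ℝ) :
    IsProbabilityMeasure (mixture μ σ) := by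
  constructor
  simp only [mixture, Measure.smul_apply, Measure.finsetSum_apply, measure_univ, smul_eq_mul,
    Finset.sum_const, Finset.card_univ, Fintype.card_fin, nsmul_eq_mul, mul_one]
  exact ENNReal.inv_mul_cancel (by exact_mod_cast NeZero.ne k) (ENNReal.natCast_ne_top k)

/-- The joint law of `m` independent samples from the mixture. -/
def sampleLaw {k : ℕ} (μ : Fin k → ℝ) (σ : ℝ) (m : ℕ) : Measure (Fin m → ℝ) :=
  Measure.pi fun _ => mixture μ σ

instance isProbabilityMeasure_sampleLaw {k : ℕ} [NeZero k] (μ : Fin k → ℝ) (σ : ℝ) (m : ℕ) :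
    IsProbabilityMeasure (sampleLaw μ σ m) := by
  unfold sampleLaw; infer_instance

/-- An admissible list of means: pairwise distinct, and all in the grid `ε ℤ`. -/
def IsGridMeans {k : ℕ} (ε : ℝ) (μ : Fin k → ℝ) : Prop :=
  Function.Injective μ ∧ ∀ i, ∃ n : ℤ, μ i = ε * n

/-- The set `{μ₁, …, μ_k}` of the means. -/
def meanSet {k : ℕ} (μ : Fin k → ℝ) : Finset ℝ :=
  letI : DecidableEq ℝ := Classical.decEq ℝ
  Finset.univ.image μ

/-- An estimator on `m` samples (a deterministic map from samples to finite sets of reals,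
measurable for the discrete σ-algebra on its values) identifies the `k` means exactly with failure
probability at most `δ`, whatever the distinct means in `ε ℤ` are. The estimator may use
`k`, `σ`, `ε`, but not the means. -/
def IdentifiesMeans (k : ℕ) (ε σ δ : ℝ) (m : ℕ) (est : (Fin m → ℝ) → Finset ℝ) : Prop :=
  Measurable[_, ⊤] est ∧
    ∀ μ : Fin k → ℝ, IsGridMeans ε μ →
      ENNReal.ofReal (1 - δ) ≤ sampleLaw μ σ m {x | est x = meanSet μ}

end GaussianMixture

end

noncomputable section

namespace GaussianMixture

/-! ### Exponential sums on short arcs -/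

section ExponentialSums

open Complex

/-! The characteristic function of a mixture on the grid is a Gaussian factor times `1/k` times an
exponential sum with coefficients 0 or 1. For two different mean sets, the difference of the two
sums is, up to a unimodular factor, a polynomial in `exp (it)` with coefficients in {-1, 0, 1} and
constant term ±1. Such a polynomial has modulus at least `exp (-32/a)` somewhere on the arc `|t| ≤
a` (`exists_norm_expSum_sub_ge`), whatever its degree. At `t = O(a/ε)` the Gaussian factor costs
`exp (-(σ/ε)² a²/2)`; taking `a` of order `(σ/ε)^(-2/3)` for large `σ/ε` balances the two losses.
This gives a frequency separating the characteristic functions by `η = k⁻¹ exp (-O(1 +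
(σ/ε)^(2/3)))` (`exists_norm_gridCharFun_sub_ge`).

The means range over an infinite grid, so the hypotheses must be cut down. One group `I` of samples
keeps the grid points with many samples within `2σ`. There are `O(k(1 + σ/ε))` of them, and with
high probability all true means are among them. A second, independent group `J` estimates the
characteristic function at the frequencies separating pairs of surviving sets. At most one candidate
agrees within `η/2` at all of them (`IsSelected.unique`).

There are `exp (O(k(1 + σ/ε)))` pairs, so Hoeffding and a union bound need about `η⁻² (k(1 + σ/ε) +
log (1/δ))` samples. Since `η⁻²` is of order `k²` times an exponential, this is the claimed bound.
The list of pairs is random, and `measure_iUnion_inter_le` makes the union bound legitimate. -/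

theorem normSq_cos (z : ℂ) : normSq (cos z) = Real.cos z.re ^ 2 + Real.sinh z.im ^ 2 := by
  rw [Complex.cos_eq z]
  have h := Real.cosh_sq z.im
  have h' := Real.sin_sq_add_cos_sq z.re
  simp only [← ofReal_cos, ← ofReal_sin, ← ofReal_cosh, ← ofReal_sinh, normSq_apply, sub_re,
    sub_im, mul_re, mul_im, ofReal_re, ofReal_im, I_re, I_im]
  linear_combination Real.cos z.re ^ 2 * h + Real.sinh z.im ^ 2 * h'

/-- The numerator is constant on vertical lines, so `1 / Re (tan z)` grows there exactly like `|cos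
z|²`. This is why division by `cos² z` tames a bound of the form `1 + 1 / Re s`. -/
theorem re_sin_div_cos (z : ℂ) :
    (sin z / cos z).re = Real.sin z.re * Real.cos z.re / normSq (cos z) := by
  have h := Real.cosh_sq z.im
  rw [div_re, ← add_div]
  congr 1
  rw [Complex.cos_eq z, Complex.sin_eq z]
  simp only [← ofReal_cos, ← ofReal_sin, ← ofReal_cosh, ← ofReal_sinh, add_re, add_im, sub_re,
    sub_im, mul_re, mul_im, ofReal_re, ofReal_im, I_re, I_im]
  linear_combination Real.cos z.re * Real.sin z.re * h

/-- The difference of two values of `arctan` at `1 / a` and `2 / a` is at least of order `a`. -/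
theorem arctan_two_div_sub_arctan_one_div {a : ℝ} (ha : 0 < a) (ha1 : a ≤ 1) :
    a / 5 ≤ Real.arctan (2 / a) - Real.arctan (1 / a) := by
  have hlt : 1 / a < 2 / a := by gcongr; norm_num
  obtain ⟨c, hc, hc'⟩ := exists_deriv_eq_slope Real.arctan hlt
    Real.continuous_arctan.continuousOn Real.differentiable_arctan.differentiableOn
  rw [Real.deriv_arctan, eq_div_iff (by linarith [sub_pos.2 hlt])] at hc'
  rw [← hc']
  have hc0 : 0 < c := lt_trans (by positivity) hc.1
  have hca : c ^ 2 ≤ (2 / a) ^ 2 := by gcongr; exact hc.2.le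
  have h5 : 1 + c ^ 2 ≤ 5 / a ^ 2 := by
    have : 1 ≤ 1 / a ^ 2 := by rw [le_div_iff₀ (by positivity)]; nlinarith
    calc 1 + c ^ 2 ≤ 1 / a ^ 2 + (2 / a) ^ 2 := by linarith
      _ = 5 / a ^ 2 := by ring
  have h6 : a ^ 2 / 5 ≤ 1 / (1 + c ^ 2) := by
    rw [div_le_div_iff₀ (by norm_num) (by positivity)]
    rw [le_div_iff₀ (by positivity)] at h5
    linarith
  calc a / 5 = a ^ 2 / 5 * (2 / a - 1 / a) := by field_simp; ring
    _ ≤ _ := by gcongr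

/-- A bounded analytic function on the right half plane which grows at most like `1 / Re s` at the
imaginary axis and is not small at `1` cannot be too small on a short vertical segment. -/
theorem exists_norm_ge_on_segment {F : ℂ → ℂ} (hF : Differentiable ℂ F) {K : ℝ}
    (hK : ∀ s : ℂ, 0 ≤ s.re → ‖F s‖ ≤ K) (hb : ∀ s : ℂ, 0 < s.re → ‖F s‖ ≤ 1 + 1 / s.re)
    (h1 : 1 / 3 ≤ ‖F 1‖) {a : ℝ} (ha : 0 < a) (ha1 : a ≤ 1) :
    ∃ t : ℝ, |t| ≤ a ∧ Real.exp (-32 / a) ≤ ‖F (t * I)‖ := by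
  by_contra! hcon
  set y₀ := Real.arctan (1 / a) with hy₀
  set y₁ := Real.arctan (2 / a) with hy₁
  have hy₀0 : 0 < y₀ := Real.arctan_pos.2 (by positivity)
  have hgap := arctan_two_div_sub_arctan_one_div ha ha1
  rw [← hy₀, ← hy₁] at hgap
  have hy₁0 : 0 < y₁ := by linarith [div_pos ha (by norm_num : (0 : ℝ) < 5)]
  have hy01 : y₀ ≤ y₁ := by linarith [div_pos ha (by norm_num : (0 : ℝ) < 5)]
  have hy₁2 : y₁ < Real.pi / 2 := Real.arctan_lt_pi_div_two _
  have hcos₁ : 0 < Real.cos y₁ := Real.cos_arctan_pos _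
  have hcosge : ∀ y, 0 ≤ y → y ≤ y₁ → Real.cos y₁ ≤ Real.cos y := fun y h0 h1 =>
    Real.cos_le_cos_of_nonneg_of_le_pi h0 (by linarith [Real.pi_pos]) h1
  have hsin : ∀ y, 0 ≤ y → y ≤ y₁ → 0 ≤ Real.sin y := fun y h0 h1 =>
    Real.sin_nonneg_of_nonneg_of_le_pi h0 (by linarith [Real.pi_pos])
  have hnsq : ∀ z : ℂ, 0 ≤ z.re → z.re ≤ y₁ → Real.cos y₁ ^ 2 ≤ normSq (cos z) := by
    intro z h0 h1
    rw [normSq_cos]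
    nlinarith [hcosge _ h0 h1, sq_nonneg (Real.sinh z.im)]
  have hre : ∀ z : ℂ, 0 ≤ z.re → z.re ≤ y₁ → 0 ≤ (a * (sin z / cos z)).re := by
    intro z h0 h1
    rw [re_ofReal_mul, re_sin_div_cos]
    have := hsin _ h0 h1
    have := hcosge _ h0 h1
    have := normSq_nonneg (cos z)
    have : 0 ≤ Real.cos z.re := by linarith
    positivity
  have hnorm : ∀ z : ℂ, ‖F (a * (sin z / cos z)) / cos z ^ 2‖
      = ‖F (a * (sin z / cos z))‖ / normSq (cos z) := by
    intro z
    rw [norm_div, norm_pow, normSq_eq_norm_sq]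
  have hstrip : closure (HadamardThreeLines.verticalStrip 0 y₁) ⊆
      HadamardThreeLines.verticalClosedStrip 0 y₁ :=
    closure_minimal (Set.preimage_mono Set.Ioo_subset_Icc_self)
      (isClosed_Icc.preimage continuous_re)
  have hy₀mem : (y₀ : ℂ) ∈ HadamardThreeLines.verticalClosedStrip 0 y₁ := by
    simp [HadamardThreeLines.verticalClosedStrip, hy₀0.le, hy01]
  -- Three lines theorem for `F (a tan z) / cos² z`. The map `z ↦ a tan z` sends the left edge into
  -- the segment from `-ia` to `ia`, keeps the strip in the right half plane, and sends `y₀` to `1`.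
  have hmain := HadamardThreeLines.norm_le_interp_of_mem_verticalClosedStrip'
    (f := fun z => F (a * (sin z / cos z)) / cos z ^ 2) (z := y₀) (a := Real.exp (-32 / a))
    (b := 15 / 2 / a ^ 2) hy₁0 hy₀mem ?_ ?_ ?_ ?_
  · simp only [ofReal_re, sub_zero] at hmain
    rw [hnorm, normSq_cos] at hmain
    simp only [ofReal_re, ofReal_im, Real.sinh_zero] at hmain
    rw [← ofReal_sin, ← ofReal_cos, ← ofReal_div, ← Real.tan_eq_sin_div_cos, ← ofReal_mul, hy₀,
      Real.tan_arctan, Real.cos_sq_arctan, ← hy₀, mul_one_div_cancel ha.ne', ofReal_one] at hmain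
    set θ := y₀ / y₁ with hθ
    have hθ1 : θ ≤ 1 := (div_le_one hy₁0).2 hy01
    -- The gap `y₁ - y₀ ≥ a/5` divided by `y₁ < π/2 < 8/5`. The constant 32 then makes the left edge
    -- contribute `exp (-4)`, which is below `2/45 = (1/3) / (15/2)`.
    have hθ2 : a / 8 ≤ 1 - θ := by
      have : 1 - θ = (y₁ - y₀) / y₁ := by rw [hθ]; field_simp
      rw [this, le_div_iff₀ hy₁0]
      have : y₁ ≤ 8 / 5 := by linarith [Real.pi_lt_d2]
      nlinarith
    have hB : 1 ≤ 15 / 2 / a ^ 2 := by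
      rw [le_div_iff₀ (by positivity)]; nlinarith
    have hBθ : (15 / 2 / a ^ 2) ^ θ ≤ 15 / 2 / a ^ 2 := by
      simpa using Real.rpow_le_rpow_of_exponent_le hB hθ1
    have hE : Real.exp (-32 / a) ^ (1 - θ) ≤ Real.exp (-4) := by
      rw [← Real.exp_mul]
      apply Real.exp_le_exp.2
      have h32 : -32 / a * (a / 8) = -4 := by field_simp; norm_num
      rw [← h32]
      exact mul_le_mul_of_nonpos_left hθ2 (div_nonpos_of_nonpos_of_nonneg (by norm_num) ha.le)
    have hL : 1 / 3 / a ^ 2 ≤ ‖F 1‖ / (1 / (1 + (1 / a) ^ 2) + 0 ^ 2) := by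
      have : ‖F 1‖ / (1 / (1 + (1 / a) ^ 2) + 0 ^ 2) = ‖F 1‖ * (1 + 1 / a ^ 2) := by
        field_simp; simp
      rw [this]
      have h2 : 0 < 1 / a ^ 2 := by positivity
      have : 1 / 3 / a ^ 2 = 1 / 3 * (1 / a ^ 2) := by ring
      rw [this]
      nlinarith
    have h3 : 1 / 3 / a ^ 2 ≤ Real.exp (-4) * (15 / 2 / a ^ 2) :=
      (hL.trans hmain).trans (mul_le_mul hE hBθ (by positivity) (by positivity))
    have h4 : Real.exp (-4) < 2 / 45 := by
      have : (2.7 : ℝ) < Real.exp 1 := lt_trans (by norm_num) Real.exp_one_gt_d9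
      have h5 : Real.exp 4 = Real.exp 1 ^ 4 := by rw [← Real.exp_nat_mul]; norm_num
      have h6 : (2.7 : ℝ) ^ 4 < Real.exp 4 := by rw [h5]; gcongr
      rw [Real.exp_neg, inv_lt_comm₀ (Real.exp_pos _) (by norm_num)]
      refine lt_trans (by norm_num) h6
    have h5 : Real.exp (-4) * (15 / 2 / a ^ 2) < 2 / 45 * (15 / 2 / a ^ 2) := by gcongr
    have h6 : (2 : ℝ) / 45 * (15 / 2 / a ^ 2) = 1 / 3 / a ^ 2 := by ring
    linarith
  · apply DifferentiableOn.diffContOnCl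
    intro z hz
    have hz' := hstrip hz
    have hc : cos z ≠ 0 := by
      rw [← normSq_pos]
      exact lt_of_lt_of_le (by positivity) (hnsq z hz'.1 hz'.2)
    apply DifferentiableAt.differentiableWithinAt
    refine DifferentiableAt.div ?_ (by fun_prop) (pow_ne_zero _ hc)
    exact hF.differentiableAt.comp z ((by fun_prop : DifferentiableAt ℂ sin z).div
      (by fun_prop) hc |>.const_mul _)
  -- The theorem only asks for some bound on the strip, so `K` does not enter the conclusion.
  · refine ⟨K / Real.cos y₁ ^ 2, ?_⟩
    rintro _ ⟨z, hz, rfl⟩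
    simp only [Function.comp_apply, hnorm]
    have h0 := hK _ (hre z hz.1 hz.2)
    exact div_le_div₀ ((norm_nonneg _).trans h0) h0 (by positivity) (hnsq z hz.1 hz.2)
  · intro z hz
    simp only [Set.mem_preimage, Set.mem_singleton_iff] at hz
    have hzI : z = z.im * I := by apply Complex.ext <;> simp [hz]
    rw [hnorm]
    have hns : 1 ≤ normSq (cos z) := by
      rw [normSq_cos, hz, Real.cos_zero]
      nlinarith [sq_nonneg (Real.sinh z.im)]
    have harg : (a : ℂ) * (sin z / cos z) = ((a * Real.tanh z.im : ℝ) : ℂ) * I := by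
      conv_lhs => rw [hzI]
      rw [Complex.sin_mul_I, Complex.cos_mul_I, Real.tanh_eq_sinh_div_cosh]
      push_cast
      ring
    rw [harg]
    have ht : |a * Real.tanh z.im| ≤ a := by
      rw [abs_mul, abs_of_pos ha]
      have : |Real.tanh z.im| ≤ 1 := (Real.abs_tanh_lt_one _).le
      nlinarith
    exact (div_le_self (norm_nonneg _) hns).trans (hcon _ ht).le
  · intro z hz
    simp only [Set.mem_preimage, Set.mem_singleton_iff] at hz
    rw [hnorm]
    have hz0 : 0 ≤ z.re := by rw [hz]; exact hy₁0.le
    have hns := hnsq z hz0 hz.le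
    have hns0 : 0 < normSq (cos z) := lt_of_lt_of_le (by positivity) hns
    have hs : 0 < Real.sin y₁ := Real.sin_pos_of_pos_of_lt_pi hy₁0 (by linarith [Real.pi_pos])
    have hre' : (a * (sin z / cos z)).re = a * (Real.sin y₁ * Real.cos y₁) / normSq (cos z) := by
      rw [re_ofReal_mul, re_sin_div_cos, hz]; ring
    have hpos : 0 < (a * (sin z / cos z)).re := by rw [hre']; positivity
    have hcsq : Real.cos y₁ ^ 2 = a ^ 2 / (a ^ 2 + 4) := by
      rw [hy₁, Real.cos_sq_arctan]; field_simp; norm_num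
    have hsc : Real.sin y₁ * Real.cos y₁ = 2 * a / (a ^ 2 + 4) := by
      have : Real.sin y₁ = 2 / a * Real.cos y₁ := by
        rw [← Real.tan_mul_cos hcos₁.ne', hy₁, Real.tan_arctan]
      rw [this, mul_assoc, ← sq, hcsq]; field_simp
    calc ‖F (a * (sin z / cos z))‖ / normSq (cos z)
        ≤ (1 + 1 / (a * (sin z / cos z)).re) / normSq (cos z) := by
          gcongr; exact hb _ hpos
      _ = 1 / normSq (cos z) + 1 / (a * (Real.sin y₁ * Real.cos y₁)) := by
          rw [hre']; field_simp
      _ ≤ 1 / Real.cos y₁ ^ 2 + 1 / (a * (Real.sin y₁ * Real.cos y₁)) := by gcongr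
      _ = (a ^ 2 + 4) * (3 / 2) / a ^ 2 := by rw [hcsq, hsc]; field_simp; norm_num
      _ ≤ 15 / 2 / a ^ 2 := by gcongr; nlinarith

/-- Comparison with the full geometric series makes the bound independent of the degree, hence of
how far apart the means are. -/
theorem sum_exp_neg_mul_le (T : Finset ℕ) {r : ℝ} (hr : 0 < r) :
    ∑ j ∈ T, Real.exp (-(j * r)) ≤ 1 + 1 / r := by
  have hlt : Real.exp (-r) < 1 := Real.exp_lt_one_iff.2 (by linarith)
  have hpow : ∀ j : ℕ, Real.exp (-(j * r)) = Real.exp (-r) ^ j := fun j => by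
    rw [← Real.exp_nat_mul]; congr 1; ring
  simp only [hpow]
  have hle : Real.exp (-r) ≤ 1 / (1 + r) := by
    rw [Real.exp_neg, one_div]
    exact inv_anti₀ (by linarith) (by linarith [Real.add_one_le_exp r])
  have hsub : r / (1 + r) ≤ 1 - Real.exp (-r) := by
    have : r / (1 + r) = 1 - 1 / (1 + r) := by field_simp; ring
    linarith
  calc ∑ j ∈ T, Real.exp (-r) ^ j ≤ ∑' j : ℕ, Real.exp (-r) ^ j :=
        (summable_geometric_of_lt_one (Real.exp_pos _).le hlt).sum_le_tsum _
          fun _ _ => by positivity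
    _ = (1 - Real.exp (-r))⁻¹ := tsum_geometric_of_lt_one (Real.exp_pos _).le hlt
    _ ≤ (r / (1 + r))⁻¹ := inv_anti₀ (by positivity) hsub
    _ = 1 + 1 / r := by field_simp; ring

theorem norm_exp_neg_natCast_mul (j : ℕ) (s : ℂ) : ‖exp (-(j * s))‖ = Real.exp (-(j * s.re)) := by
  rw [norm_exp]; simp

/-- A power series polynomial with coefficients in the unit disc and unimodular constant term is at
least `exp (-32 / a)` somewhere on the arc `|t| ≤ a`. -/
theorem exists_norm_natExpSum_ge {T : Finset ℕ} (h0 : 0 ∈ T) {c : ℕ → ℂ} (hc : ∀ j ∈ T, ‖c j‖ ≤ 1)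
    (hc0 : ‖c 0‖ = 1) {a : ℝ} (ha : 0 < a) (ha1 : a ≤ 1) :
    ∃ t : ℝ, |t| ≤ a ∧ Real.exp (-32 / a) ≤ ‖∑ j ∈ T, c j * exp (j * t * I)‖ := by
  have hle : ∀ U ⊆ T, ∀ s : ℂ, ‖∑ j ∈ U, c j * exp (-(j * s))‖ ≤
      ∑ j ∈ U, Real.exp (-(j * s.re)) := by
    intro U hU s
    refine (norm_sum_le _ _).trans (Finset.sum_le_sum fun j hj => ?_)
    rw [norm_mul, norm_exp_neg_natCast_mul]
    exact mul_le_of_le_one_left (Real.exp_pos _).le (hc j (hU hj))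
  have hK : ∀ s : ℂ, 0 ≤ s.re → ‖∑ j ∈ T, c j * exp (-(j * s))‖ ≤ T.card := by
    intro s hs
    refine (hle T subset_rfl s).trans ?_
    rw [Finset.cast_card]
    refine Finset.sum_le_sum fun j _ => ?_
    rw [Real.exp_le_one_iff]
    have : 0 ≤ j * s.re := by positivity
    linarith
  have hb : ∀ s : ℂ, 0 < s.re → ‖∑ j ∈ T, c j * exp (-(j * s))‖ ≤ 1 + 1 / s.re := by
    intro s hs
    exact (hle T subset_rfl s).trans (sum_exp_neg_mul_le T hs)
  have h1 : 1 / 3 ≤ ‖∑ j ∈ T, c j * exp (-(j * 1))‖ := by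
    have hsplit := Finset.add_sum_erase T (fun j : ℕ => c j * exp (-(j * 1))) h0
    have h1 := hle (T.erase 0) (Finset.erase_subset _ _) 1
    simp only [one_re, mul_one] at h1 hsplit ⊢
    -- The tail is at most `1/(e - 1) < 2/3`, which leaves `1/3` of the unimodular constant term.
    have h2 : ∑ j ∈ T.erase 0, Real.exp (-(j : ℝ)) ≤ 2 / 3 := by
      set U := (T.erase 0).image (fun j => j - 1) with hU
      have hinj : Set.InjOn (fun j : ℕ => j - 1) (T.erase 0 : Finset ℕ) := by
        intro i hi j hj hij
        simp only [Finset.coe_erase, Set.mem_sdiff, Set.mem_singleton_iff] at hi hj hij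
        omega
      have h3 : ∑ j ∈ T.erase 0, Real.exp (-(j : ℝ)) =
          Real.exp (-1) * ∑ i ∈ U, Real.exp (-(i * 1)) := by
        rw [hU, Finset.sum_image hinj, Finset.mul_sum]
        refine Finset.sum_congr rfl fun j hj => ?_
        rw [← Real.exp_add]
        congr 1
        have : 1 ≤ j := Nat.one_le_iff_ne_zero.2 (Finset.ne_of_mem_erase hj)
        push_cast [Nat.cast_sub this]
        ring
      have hlt : Real.exp (-1) < 3679 / 10000 := by
        refine lt_trans Real.exp_neg_one_lt_d9 (by norm_num)
      have h4 : ∑ i ∈ U, Real.exp (-(i * 1)) ≤ (1 - Real.exp (-1))⁻¹ := by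
        have hpow : ∀ j : ℕ, Real.exp (-(j * 1)) = Real.exp (-1) ^ j := fun j => by
          rw [← Real.exp_nat_mul]; congr 1; ring
        simp only [hpow]
        rw [← tsum_geometric_of_lt_one (Real.exp_pos _).le (by linarith)]
        exact (summable_geometric_of_lt_one (Real.exp_pos _).le (by linarith)).sum_le_tsum _
          fun _ _ => by positivity
      rw [h3]
      calc _ ≤ Real.exp (-1) * (1 - Real.exp (-1))⁻¹ := by gcongr
        _ ≤ 2 / 3 := by
          rw [← div_eq_mul_inv, div_le_iff₀ (by linarith)]
          linarith
    have h5 : ‖c 0 * exp (-((0 : ℕ) : ℂ))‖ = 1 := by simp [hc0]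
    have h6 := norm_sub_le_norm_add (c 0 * exp (-((0 : ℕ) : ℂ)))
      (∑ j ∈ T.erase 0, c j * exp (-(j : ℂ)))
    rw [hsplit, h5] at h6
    linarith
  obtain ⟨t, ht, h⟩ := exists_norm_ge_on_segment (F := fun s => ∑ j ∈ T, c j * exp (-(j * s)))
    (by fun_prop) hK hb h1 ha ha1
  refine ⟨-t, by rwa [abs_neg], h.trans_eq ?_⟩
  congr 1
  refine Finset.sum_congr rfl fun j _ => ?_
  congr 2
  push_cast
  ring

/-- Exponential sums with two distinct finite integer spectra differ by at least `exp (-32 / a)`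
somewhere on the arc `|t| ≤ a`. -/
theorem exists_norm_expSum_sub_ge {A B : Finset ℤ} (hAB : A ≠ B) {a : ℝ} (ha : 0 < a)
    (ha1 : a ≤ 1) :
    ∃ t : ℝ, |t| ≤ a ∧ Real.exp (-32 / a) ≤
      ‖∑ n ∈ A, exp (n * t * I) - ∑ n ∈ B, exp (n * t * I)‖ := by
  set S := symmDiff A B with hS
  have hne : S.Nonempty := by
    rw [Finset.nonempty_iff_ne_empty, Ne, ← Finset.bot_eq_empty, hS, symmDiff_eq_bot]
    exact hAB
  -- Common frequencies cancel. Factoring out the smallest remaining one does not change the modulus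
  -- and creates a constant term ±1.
  set n₀ := S.min' hne with hn₀
  have hmin : ∀ n ∈ S, n₀ ≤ n := fun n hn => S.min'_le n hn
  have hn₀S : n₀ ∈ S := S.min'_mem hne
  set d : ℤ → ℂ := fun n => (if n ∈ A then 1 else 0) - (if n ∈ B then 1 else 0) with hd
  have hdS : ∀ n ∈ S, ‖d n‖ = 1 := by
    intro n hn
    rw [hS, Finset.mem_symmDiff] at hn
    rcases hn with ⟨h1, h2⟩ | ⟨h1, h2⟩ <;> simp [hd, h1, h2]
  have hdS' : ∀ n ∈ A ∪ B, n ∉ S → d n = 0 := by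
    intro n hn hnS
    rw [hS, Finset.mem_symmDiff] at hnS
    rw [Finset.mem_union] at hn
    have hA : n ∈ A := by tauto
    have hB : n ∈ B := by tauto
    simp [hd, hA, hB]
  have hinj : Set.InjOn (fun n : ℤ => (n - n₀).toNat) (S : Set ℤ) := by
    intro i hi j hj hij
    have := hmin i hi
    have := hmin j hj
    simp only at hij
    omega
  set T := S.image (fun n : ℤ => (n - n₀).toNat) with hT
  have hback : ∀ n ∈ S, n₀ + ((n - n₀).toNat : ℤ) = n := fun n hn => by
    have := hmin n hn
    omega
  obtain ⟨t, ht, h⟩ := exists_norm_natExpSum_ge (T := T) (c := fun j => d (n₀ + j))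
    (Finset.mem_image.2 ⟨n₀, hn₀S, by simp⟩) (fun j hj => by
      obtain ⟨n, hn, rfl⟩ := Finset.mem_image.1 hj
      rw [hback n hn, hdS n hn]) (by simpa using hdS n₀ hn₀S) ha ha1
  refine ⟨t, ht, h.trans_eq ?_⟩
  rw [hT, Finset.sum_image hinj]
  have hu : ‖exp ((n₀ : ℂ) * t * I)‖ = 1 := by
    have := norm_exp_ofReal_mul_I (n₀ * t)
    push_cast at this
    exact this
  rw [← one_mul ‖∑ n ∈ S, _‖, ← hu, ← norm_mul, Finset.mul_sum]
  congr 1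
  calc ∑ n ∈ S, exp ((n₀ : ℂ) * t * I) * (d (n₀ + ((n - n₀).toNat : ℤ)) *
        exp (((n - n₀).toNat : ℂ) * t * I))
      = ∑ n ∈ S, d n * exp (n * t * I) := by
        refine Finset.sum_congr rfl fun n hn => ?_
        have h' : (((n - n₀).toNat : ℕ) : ℂ) = (n : ℂ) - n₀ := by
          have : (((n - n₀).toNat : ℤ) : ℂ) = ((n - n₀ : ℤ) : ℂ) := by
            congr 1
            have := hmin n hn
            omega
          push_cast at this
          exact this
        rw [hback n hn, h', mul_left_comm, ← exp_add]
        congr 2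
        ring
    _ = ∑ n ∈ A ∪ B, d n * exp (n * t * I) := by
        refine Finset.sum_subset (fun n hn => ?_) fun n hn hnS => ?_
        · rw [hS, Finset.mem_symmDiff] at hn
          rw [Finset.mem_union]
          tauto
        · rw [hdS' n hn hnS, zero_mul]
    _ = _ := by
        simp only [hd, sub_mul, ite_mul, one_mul, zero_mul, Finset.sum_sub_distrib,
          Finset.sum_ite_mem]
        rw [Finset.inter_eq_right.2 Finset.subset_union_left,
          Finset.inter_eq_right.2 Finset.subset_union_right]

end ExponentialSums

/-! ### Concentration for independent samples -/

section Concentration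

variable {m : ℕ} {ν : Measure ℝ} [IsProbabilityMeasure ν]

/-- Hoeffding: a variable with values in an interval of length 2 is sub-Gaussian with variance proxy
1 after centering. -/
theorem measure_sum_sub_ge_le {g : ℝ → ℝ} (hg : Measurable g) (hb : ∀ x, g x ∈ Set.Icc (-1) 1)
    (s : Finset (Fin m)) {r : ℝ} (hr : 0 ≤ r) :
    (Measure.pi fun _ : Fin m => ν).real
      {x | s.card * r ≤ ∑ j ∈ s, g (x j) - s.card * ∫ y, g y ∂ν} ≤
      Real.exp (-(s.card * r ^ 2 / 2)) := by
  set P := Measure.pi fun _ : Fin m => ν with hP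
  have hind : iIndepFun (fun (j : Fin m) (x : Fin m → ℝ) => g (x j) - ∫ y, g y ∂ν) P :=
    iIndepFun_pi (X := fun _ y => g y - ∫ y, g y ∂ν) fun _ => (hg.sub_const _).aemeasurable
  have hsub : ∀ j ∈ s, HasSubgaussianMGF (fun x : Fin m → ℝ => g (x j) - ∫ y, g y ∂ν) 1 P := by
    intro j _
    have h := hasSubgaussianMGF_of_mem_Icc (μ := P) (X := fun x : Fin m → ℝ => g (x j))
      (a := -1) (b := 1) (hg.comp (measurable_pi_apply j)).aemeasurable
      (Filter.Eventually.of_forall fun x => hb (x j))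
    have h1 : ∫ x, g (x j) ∂P = ∫ y, g y ∂ν :=
      integral_comp_eval (μ := fun _ : Fin m => ν) (i := j) hg.aestronglyMeasurable
    have h2 : (‖(1 : ℝ) - -1‖₊ / 2) ^ 2 = 1 := by
      have : ‖(1 : ℝ) - -1‖₊ = 2 := by
        ext; simp; norm_num
      rw [this]; simp
    rwa [h1, h2] at h
  have h := HasSubgaussianMGF.measure_sum_ge_le_of_iIndepFun hind hsub
    (ε := s.card * r) (by positivity)
  simp only [Finset.sum_sub_distrib, Finset.sum_const, nsmul_eq_mul, mul_one,
    NNReal.coe_natCast] at h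
  refine h.trans_eq ?_
  congr 1
  -- For empty `s` the exponent divides by zero, and both sides take the value 0 there.
  rcases Nat.eq_zero_or_pos s.card with h0 | h0
  · simp [h0]
  · have : (s.card : ℝ) ≠ 0 := by positivity
    field_simp

/-- Hoeffding's inequality for the average of a test function over a set of samples. -/
theorem measure_abs_sum_sub_ge_le {g : ℝ → ℝ} (hg : Measurable g)
    (hb : ∀ x, g x ∈ Set.Icc (-1) 1) (s : Finset (Fin m)) {r : ℝ} (hr : 0 ≤ r) :
    (Measure.pi fun _ : Fin m => ν).real
      {x | s.card * r ≤ |∑ j ∈ s, g (x j) - s.card * ∫ y, g y ∂ν|} ≤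
      2 * Real.exp (-(s.card * r ^ 2 / 2)) := by
  have h1 := measure_sum_sub_ge_le (ν := ν) hg hb s hr
  have h2 := measure_sum_sub_ge_le (ν := ν) (g := fun x => -g x) hg.neg
    (fun x => by have := hb x; constructor <;> linarith [this.1, this.2]) s hr
  rw [two_mul]
  refine le_trans (le_trans (measureReal_mono ?_) (measureReal_union_le _ _)) (add_le_add h1 h2)
  intro x hx
  simp only [Set.mem_ofPred_eq, Set.mem_union, le_abs, Finset.sum_neg_distrib,
    integral_neg] at hx ⊢
  rcases hx with hx | hx
  · exact Or.inl hx
  · right; linarith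

/-- The empirical characteristic function of the samples with index in `s`. -/
def empiricalCharFun (s : Finset (Fin m)) (x : Fin m → ℝ) (t : ℝ) : ℂ :=
  (s.card : ℂ)⁻¹ * ∑ j ∈ s, Complex.exp (t * x j * Complex.I)

theorem integrable_exp_mul_I (t : ℝ) :
    Integrable (fun y : ℝ => Complex.exp (t * y * Complex.I)) ν := by
  refine Integrable.of_bound (by fun_prop) 1 (Filter.Eventually.of_forall fun y => ?_)
  rw [← Complex.ofReal_mul, Complex.norm_exp_ofReal_mul_I]

/-- A deviation `r` forces a deviation `r/2` of the real or of the imaginary part. Hoeffding applies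
to each, with test functions `cos (t y)` and `sin (t y)`. -/
theorem measure_norm_empiricalCharFun_sub_ge_le {s : Finset (Fin m)} (hs : s.Nonempty) (t : ℝ)
    {r : ℝ} (hr : 0 ≤ r) :
    (Measure.pi fun _ : Fin m => ν).real {x | r ≤ ‖empiricalCharFun s x t - charFun ν t‖} ≤
      4 * Real.exp (-(s.card * r ^ 2 / 8)) := by
  have hc : (0 : ℝ) < s.card := by exact_mod_cast hs.card_pos
  have hcos := measure_abs_sum_sub_ge_le (ν := ν) (g := fun y => Real.cos (t * y))
    (by fun_prop) (fun y => ⟨Real.neg_one_le_cos _, Real.cos_le_one _⟩) s (r := r / 2)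
    (by positivity)
  have hsin := measure_abs_sum_sub_ge_le (ν := ν) (g := fun y => Real.sin (t * y))
    (by fun_prop) (fun y => ⟨Real.neg_one_le_sin _, Real.sin_le_one _⟩) s (r := r / 2)
    (by positivity)
  have hexp : ∀ y : ℝ, Complex.exp (t * y * Complex.I) =
      (Real.cos (t * y) : ℂ) + (Real.sin (t * y) : ℂ) * Complex.I := fun y => by
    rw [← Complex.ofReal_mul, Complex.exp_mul_I, Complex.ofReal_cos, Complex.ofReal_sin]
  have hRe : (charFun ν t).re = ∫ y, Real.cos (t * y) ∂ν := by
    rw [charFun_apply_real, ← Complex.reCLM_apply,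
      ← ContinuousLinearMap.integral_comp_comm _ (integrable_exp_mul_I t)]
    refine integral_congr_ae (Filter.Eventually.of_forall fun y => ?_)
    simp only [hexp, Complex.reCLM_apply]
    simp [-Complex.ofReal_cos, -Complex.ofReal_sin]
  have hIm : (charFun ν t).im = ∫ y, Real.sin (t * y) ∂ν := by
    rw [charFun_apply_real, ← Complex.imCLM_apply,
      ← ContinuousLinearMap.integral_comp_comm _ (integrable_exp_mul_I t)]
    refine integral_congr_ae (Filter.Eventually.of_forall fun y => ?_)
    simp only [hexp, Complex.imCLM_apply]
    simp [-Complex.ofReal_cos, -Complex.ofReal_sin]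
  have hemp : ∀ x : Fin m → ℝ, empiricalCharFun s x t =
      (((s.card : ℝ)⁻¹ * ∑ j ∈ s, Real.cos (t * x j) : ℝ) : ℂ) +
      (((s.card : ℝ)⁻¹ * ∑ j ∈ s, Real.sin (t * x j) : ℝ) : ℂ) * Complex.I := by
    intro x
    simp only [empiricalCharFun, hexp, Finset.sum_add_distrib, ← Finset.sum_mul]
    push_cast
    ring
  have hsplit : (4 : ℝ) * Real.exp (-(s.card * r ^ 2 / 8)) =
      2 * Real.exp (-(s.card * (r / 2) ^ 2 / 2)) + 2 * Real.exp (-(s.card * (r / 2) ^ 2 / 2)) := by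
    rw [show s.card * (r / 2) ^ 2 / 2 = s.card * r ^ 2 / 8 by ring]; ring
  rw [hsplit]
  refine le_trans (le_trans (measureReal_mono ?_) (measureReal_union_le _ _))
    (add_le_add hcos hsin)
  intro x hx
  simp only [Set.mem_ofPred_eq, Set.mem_union] at hx ⊢
  by_contra! hcon
  have hn := Complex.norm_le_abs_re_add_abs_im (empiricalCharFun s x t - charFun ν t)
  rw [Complex.sub_re, Complex.sub_im, hRe, hIm, hemp] at hn
  simp only [Complex.add_re, Complex.add_im, Complex.re_ofReal_mul, Complex.im_ofReal_mul,
    Complex.ofReal_re, Complex.ofReal_im, Complex.I_re, Complex.I_im, mul_zero, mul_one, add_zero,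
    zero_add] at hn
  have key : ∀ S E : ℝ, |S - s.card * E| < s.card * (r / 2) → |(s.card : ℝ)⁻¹ * S - E| < r / 2 := by
    intro S E h
    have : (s.card : ℝ)⁻¹ * S - E = (s.card : ℝ)⁻¹ * (S - s.card * E) := by field_simp
    rw [this, abs_mul, abs_of_pos (inv_pos.2 hc), inv_mul_lt_iff₀ hc]
    exact h
  rw [hemp] at hx
  linarith [key _ _ hcon.1, key _ _ hcon.2]

end Concentration

/-! ### Mixtures with means on a grid -/

section Mixture

/-- The characteristic function of the mixture with means `ε n`, `n ∈ A`. -/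
def gridCharFun (k : ℕ) (ε σ : ℝ) (A : Finset ℤ) (t : ℝ) : ℂ :=
  (k : ℂ)⁻¹ * (∑ n ∈ A, Complex.exp (n * (ε * t : ℝ) * Complex.I)) *
    (Real.exp (-(σ ^ 2 * t ^ 2 / 2)) : ℂ)

variable {k : ℕ} {ε σ : ℝ}

theorem integral_mixture (μ : Fin k → ℝ) (σ : ℝ) {E : Type*} [NormedAddCommGroup E]
    [NormedSpace ℝ E] {g : ℝ → E} (hg : ∀ i, Integrable g (gaussianReal (μ i) (σ ^ 2).toNNReal)) :
    ∫ y, g y ∂mixture μ σ =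
      (k : ℝ)⁻¹ • ∑ i, ∫ y, g y ∂gaussianReal (μ i) (σ ^ 2).toNNReal := by
  rw [mixture, integral_smul_measure, integral_finsetSum_measure fun i _ => hg i]
  simp

theorem charFun_mixture {ν : Fin k → ℤ} (hν : Function.Injective ν) (t : ℝ) :
    charFun (mixture (fun i => ε * ν i) σ) t =
      gridCharFun k ε σ (Finset.univ.image ν) t := by
  rw [charFun_apply_real, integral_mixture _ _ fun i => integrable_exp_mul_I t]
  simp only [← charFun_apply_real, charFun_gaussianReal, gridCharFun]
  rw [Finset.sum_image hν.injOn, mul_assoc, Finset.sum_mul, Complex.real_smul]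
  push_cast
  congr 1
  refine Finset.sum_congr rfl fun i _ => ?_
  rw [← Complex.exp_add]
  congr 1
  have : (((σ ^ 2).toNNReal : ℝ≥0) : ℂ) = (σ : ℂ) ^ 2 := by
    rw [← Complex.ofReal_pow]
    congr 1
    exact Real.coe_toNNReal _ (sq_nonneg σ)
  simp only [this]
  ring

/-- Mixtures on the grid with different mean sets are separated in characteristic function. -/
theorem exists_norm_gridCharFun_sub_ge (hk : 1 ≤ k) (hε : 0 < ε) (hσ : 0 < σ) {A B : Finset ℤ}
    (hAB : A ≠ B) :
    ∃ t : ℝ, (k : ℝ)⁻¹ * Real.exp (-(33 * (1 + (σ / ε) ^ ((2 : ℝ) / 3)))) ≤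
      ‖gridCharFun k ε σ A t - gridCharFun k ε σ B t‖ := by
  set x := (σ / ε) ^ ((2 : ℝ) / 3) with hx
  have hx0 : 0 < x := by positivity
  have hx3 : x ^ 3 = (σ / ε) ^ 2 := by
    rw [hx, ← Real.rpow_natCast, ← Real.rpow_natCast, ← Real.rpow_mul (by positivity)]
    norm_num
  -- With this `a` the arc costs `32 (1 + x)` in the exponent, and the Gaussian factor at most `x³
  -- a²/2 ≤ x`; together at most `33 (1 + x)`.
  obtain ⟨t, ht, h⟩ := exists_norm_expSum_sub_ge hAB (a := 1 / (1 + x)) (by positivity)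
    (by rw [div_le_one (by positivity)]; linarith)
  refine ⟨t / ε, ?_⟩
  have hfac : gridCharFun k ε σ A (t / ε) - gridCharFun k ε σ B (t / ε) =
      (k : ℂ)⁻¹ * (∑ n ∈ A, Complex.exp (n * t * Complex.I) -
        ∑ n ∈ B, Complex.exp (n * t * Complex.I)) *
      (Real.exp (-(σ ^ 2 * (t / ε) ^ 2 / 2)) : ℂ) := by
    simp only [gridCharFun, mul_div_cancel₀ t hε.ne']
    ring
  rw [hfac, norm_mul, norm_mul, norm_inv, Complex.norm_natCast, Complex.norm_real,
    Real.norm_of_nonneg (Real.exp_pos _).le, mul_assoc]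
  refine mul_le_mul_of_nonneg_left ?_ (by positivity)
  refine le_trans ?_ (mul_le_mul_of_nonneg_right h (Real.exp_pos _).le)
  rw [← Real.exp_add]
  apply Real.exp_le_exp.2
  have ht2 : t ^ 2 ≤ (1 / (1 + x)) ^ 2 := by
    rw [← sq_abs]; gcongr
  have h1 : σ ^ 2 * (t / ε) ^ 2 / 2 ≤ x := by
    calc σ ^ 2 * (t / ε) ^ 2 / 2 = x ^ 3 * t ^ 2 / 2 := by rw [hx3]; ring
      _ ≤ x ^ 3 * (1 / (1 + x)) ^ 2 / 2 := by gcongr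
      _ ≤ x := by
        rw [one_div, inv_pow, ← div_eq_mul_inv, div_div, div_le_iff₀ (by positivity)]
        nlinarith [pow_pos hx0 2, pow_pos hx0 3]
  have h2 : -32 / (1 / (1 + x)) = -(32 * (1 + x)) := by field_simp
  rw [h2]
  linarith

theorem gaussianReal_compl_window_le (c : ℝ) (hσ : 0 < σ) :
    (gaussianReal c (σ ^ 2).toNNReal).real {y | 2 * σ ≤ |y - c|} ≤ 1 / 4 := by
  have h := meas_ge_le_variance_div_sq (μ := gaussianReal c (σ ^ 2).toNNReal) (X := id)
    (memLp_id_gaussianReal 2) (c := 2 * σ) (by positivity)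
  rw [variance_id_gaussianReal] at h
  simp only [id, integral_id_gaussianReal] at h
  refine ENNReal.toReal_le_of_le_ofReal (by norm_num) (h.trans_eq ?_)
  congr 1
  rw [Real.coe_toNNReal _ (sq_nonneg σ)]
  field_simp
  norm_num

/-- The indicator function of the window of radius `2σ` around `c`. -/
def window (σ c : ℝ) : ℝ → ℝ := Set.indicator {y | |y - c| ≤ 2 * σ} 1

theorem measurableSet_window (σ c : ℝ) : MeasurableSet {y : ℝ | |y - c| ≤ 2 * σ} :=
  measurableSet_le (by fun_prop) measurable_const

theorem measurable_window (σ c : ℝ) : Measurable (window σ c) :=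
  measurable_one.indicator (measurableSet_window σ c)

theorem window_nonneg (σ c y : ℝ) : 0 ≤ window σ c y :=
  Set.indicator_nonneg (fun _ _ => zero_le_one) _

theorem window_le_one (σ c y : ℝ) : window σ c y ≤ 1 :=
  Set.indicator_le_self' (fun _ _ => zero_le_one) _

/-- The `i`-th component alone has mass at least `3/4` in its window by Chebyshev, and its weight is
`1/k`. -/
theorem integral_window_ge (μ : Fin k → ℝ) (hσ : 0 < σ) (i : Fin k) :
    (3 : ℝ) / (4 * k) ≤ ∫ y, window σ (μ i) y ∂mixture μ σ := by
  have hint : ∀ j, Integrable (window σ (μ i)) (gaussianReal (μ j) (σ ^ 2).toNNReal) := fun j =>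
    Integrable.of_mem_Icc 0 1 (measurable_window _ _).aemeasurable
      (Filter.Eventually.of_forall fun y => ⟨window_nonneg _ _ _, window_le_one _ _ _⟩)
  rw [integral_mixture μ σ hint, smul_eq_mul]
  have hi : (3 : ℝ) / 4 ≤ ∫ y, window σ (μ i) y ∂gaussianReal (μ i) (σ ^ 2).toNNReal := by
    rw [window, integral_indicator_one (measurableSet_window _ _)]
    have h1 := gaussianReal_compl_window_le (μ i) hσ
    have h2 := probReal_add_probReal_compl (μ := gaussianReal (μ i) (σ ^ 2).toNNReal)
      (measurableSet_window σ (μ i))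
    have h3 : (gaussianReal (μ i) (σ ^ 2).toNNReal).real {y : ℝ | |y - μ i| ≤ 2 * σ}ᶜ ≤ 1 / 4 := by
      refine (measureReal_mono fun y hy => ?_).trans h1
      simp only [Set.mem_compl_iff, Set.mem_ofPred_eq, not_le] at hy ⊢
      exact hy.le
    linarith
  have hsum := Finset.single_le_sum
    (f := fun j => ∫ y, window σ (μ i) y ∂gaussianReal (μ j) (σ ^ 2).toNNReal)
    (fun j _ => integral_nonneg fun y => window_nonneg _ _ _) (Finset.mem_univ i)
  calc (3 : ℝ) / (4 * k) = (k : ℝ)⁻¹ * (3 / 4) := by ring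
    _ ≤ _ := mul_le_mul_of_nonneg_left (hi.trans hsum) (by positivity)

end Mixture

/-! ### Selecting a hypothesis from a random finite list -/

section RandomUnionBound

/-- A union bound over a random list: `∑ P (E i)` is the expected number of events `E i` that occur,
hence at most `N`, even for infinitely many indices. Independence will supply the product
hypothesis. -/
theorem measure_iUnion_inter_le {Ω ι : Type*} [MeasurableSpace Ω] [Countable ι] (P : Measure Ω)
    [IsProbabilityMeasure P] {E B : ι → Set Ω} (hE : ∀ i, MeasurableSet (E i)) {β N : ℝ≥0∞}
    (h : ∀ i, P (E i ∩ B i) ≤ P (E i) * β) (hN : ∀ x, (({i | x ∈ E i}.encard : ℕ∞) : ℝ≥0∞) ≤ N) :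
    P (⋃ i, E i ∩ B i) ≤ N * β := by
  have hcount : ∑' i, P (E i) ≤ N := by
    have h1 : ∀ i, P (E i) = ∫⁻ x, (E i).indicator 1 x ∂P := fun i =>
      (lintegral_indicator_one (hE i)).symm
    simp only [h1]
    rw [← lintegral_tsum fun i => (measurable_one.indicator (hE i)).aemeasurable]
    calc ∫⁻ x, ∑' i, (E i).indicator 1 x ∂P ≤ ∫⁻ _, N ∂P := by
          refine lintegral_mono fun x => ?_
          refine le_trans (le_of_eq ?_) (hN x)
          rw [← ENNReal.tsum_set_one, tsum_subtype {i | x ∈ E i} fun _ => (1 : ℝ≥0∞)]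
          rfl
      _ = N := by simp
  calc P (⋃ i, E i ∩ B i) ≤ ∑' i, P (E i ∩ B i) := measure_iUnion_le _
    _ ≤ ∑' i, P (E i) * β := ENNReal.tsum_le_tsum h
    _ = (∑' i, P (E i)) * β := ENNReal.tsum_mul_right
    _ ≤ N * β := by gcongr

variable {m : ℕ}

/-- Measurability with respect to the samples in `s` only, the form in which independence of
disjoint groups is used. -/
theorem measurable_comap_sum (s : Finset (Fin m)) {E : Type*} [AddCommMonoid E]
    [MeasurableSpace E] [MeasurableAdd₂ E] {g : ℝ → E} (hg : Measurable g) :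
    Measurable[MeasurableSpace.comap (fun (x : Fin m → ℝ) (j : s) => x j) inferInstance]
      fun x : Fin m → ℝ => ∑ j ∈ s, g (x j) := by
  have h1 : Measurable fun u : s → ℝ => ∑ j : s, g (u j) :=
    Finset.measurable_fun_sum _ fun j _ => hg.comp (measurable_pi_apply j)
  have h2 : (fun x : Fin m → ℝ => ∑ j ∈ s, g (x j)) =
      (fun u : s → ℝ => ∑ j : s, g (u j)) ∘ fun (x : Fin m → ℝ) (j : s) => x j := by
    ext x
    exact (Finset.sum_coe_sort s fun j => g (x j)).symm
  rw [h2]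
  exact h1.comp (comap_measurable _)

/-- Events depending on disjoint sets of samples are independent. -/
theorem measure_inter_of_disjoint {ν : Measure ℝ} [IsProbabilityMeasure ν] {I J : Finset (Fin m)}
    (hIJ : Disjoint I J) {E B : Set (Fin m → ℝ)}
    (hE : MeasurableSet[MeasurableSpace.comap (fun (x : Fin m → ℝ) (j : I) => x j) inferInstance] E)
    (hB : MeasurableSet[MeasurableSpace.comap (fun (x : Fin m → ℝ) (j : J) => x j) inferInstance]
      B) :
    (Measure.pi fun _ : Fin m => ν) (E ∩ B) =
      (Measure.pi fun _ : Fin m => ν) E * (Measure.pi fun _ : Fin m => ν) B := by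
  have h : iIndepFun (fun (j : Fin m) (x : Fin m → ℝ) => x j) (Measure.pi fun _ : Fin m => ν) :=
    iIndepFun_pi (X := fun _ y => y) fun _ => aemeasurable_id
  exact (Indep_iff _ _ _).1 (h.indepFun_finset I J hIJ fun j => measurable_pi_apply j) E B hE hB

end RandomUnionBound

/-! ### Candidate sets, pairwise tests and the estimator -/

section Candidates

variable {m : ℕ}

/-- `A` is a candidate for the set of mean indices if every point of the grid in it has many
samples nearby. -/
def IsCandidate (k : ℕ) (ε σ : ℝ) (I : Finset (Fin m)) (x : Fin m → ℝ) (A : Finset ℤ) : Prop :=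
  ∀ n ∈ A, (I.card : ℝ) / (2 * k) ≤ ∑ j ∈ I, window σ (ε * n) (x j)

/-- The indices that count lie in an interval of length `4σ/ε`. -/
theorem sum_window_le {ε σ : ℝ} (hε : 0 < ε) (hσ : 0 < σ) (A : Finset ℤ) (y : ℝ) :
    ∑ n ∈ A, window σ (ε * n) y ≤ 4 * (σ / ε) + 1 := by
  classical
  have h1 : ∑ n ∈ A, window σ (ε * n) y = (A.filter fun n : ℤ => |y - ε * n| ≤ 2 * σ).card := by
    rw [Finset.cast_card, Finset.sum_filter]
    refine Finset.sum_congr rfl fun n _ => ?_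
    simp [window, Set.indicator_apply]
  have h2 : (A.filter fun n : ℤ => |y - ε * n| ≤ 2 * σ) ⊆
      Finset.Icc ⌈(y - 2 * σ) / ε⌉ ⌊(y + 2 * σ) / ε⌋ := by
    intro n hn
    rw [Finset.mem_filter, abs_le] at hn
    rw [Finset.mem_Icc, Int.ceil_le, Int.le_floor, div_le_iff₀ hε, le_div_iff₀ hε]
    constructor <;> linarith [hn.2.1, hn.2.2]
  have h3 := Finset.card_le_card h2
  rw [Int.card_Icc] at h3
  rw [h1]
  have h4 : ((⌊(y + 2 * σ) / ε⌋ + 1 - ⌈(y - 2 * σ) / ε⌉).toNat : ℝ) ≤ 4 * (σ / ε) + 1 := by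
    rcases le_total 0 (⌊(y + 2 * σ) / ε⌋ + 1 - ⌈(y - 2 * σ) / ε⌉) with h | h
    · have : ((⌊(y + 2 * σ) / ε⌋ + 1 - ⌈(y - 2 * σ) / ε⌉).toNat : ℝ) =
          ((⌊(y + 2 * σ) / ε⌋ + 1 - ⌈(y - 2 * σ) / ε⌉ : ℤ) : ℝ) := by
        exact_mod_cast congrArg (Int.cast : ℤ → ℝ) (Int.toNat_of_nonneg h)
      rw [this]
      push_cast
      have h5 := Int.floor_le ((y + 2 * σ) / ε)
      have h6 := Int.le_ceil ((y - 2 * σ) / ε)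
      have h7 : (y + 2 * σ) / ε - (y - 2 * σ) / ε = 4 * (σ / ε) := by ring
      linarith
    · rw [Int.toNat_of_nonpos h]
      have : 0 < σ / ε := by positivity
      push_cast
      linarith
  exact le_trans (by exact_mod_cast h3) h4

variable {k : ℕ} {ε σ : ℝ} {I J : Finset (Fin m)} {x : Fin m → ℝ} {A : Finset ℤ}

/-- Double counting: each point of `A` claims a fraction `1/(2k)` of the samples, and each sample
serves at most `4σ/ε + 1` points. -/
theorem IsCandidate.card_le (hk : 1 ≤ k) (hε : 0 < ε) (hσ : 0 < σ) (hI : I.Nonempty)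
    (hA : IsCandidate k ε σ I x A) : (A.card : ℝ) ≤ 2 * k * (4 * (σ / ε) + 1) := by
  have hc : (0 : ℝ) < I.card := by exact_mod_cast hI.card_pos
  have hk' : (0 : ℝ) < k := by exact_mod_cast hk
  have h1 : A.card * ((I.card : ℝ) / (2 * k)) ≤ I.card * (4 * (σ / ε) + 1) := by
    calc A.card * ((I.card : ℝ) / (2 * k)) = ∑ n ∈ A, (I.card : ℝ) / (2 * k) := by
          rw [Finset.sum_const, nsmul_eq_mul]
      _ ≤ ∑ n ∈ A, ∑ j ∈ I, window σ (ε * n) (x j) := Finset.sum_le_sum hA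
      _ = ∑ j ∈ I, ∑ n ∈ A, window σ (ε * n) (x j) := Finset.sum_comm
      _ ≤ ∑ j ∈ I, (4 * (σ / ε) + 1) := Finset.sum_le_sum fun j _ => sum_window_le hε hσ A _
      _ = _ := by rw [Finset.sum_const, nsmul_eq_mul]
  have h2 : A.card * ((I.card : ℝ) / (2 * k)) = A.card / (2 * k) * I.card := by ring
  rw [h2, mul_comm (I.card : ℝ)] at h1
  have h3 := le_of_mul_le_mul_right h1 hc
  rw [div_le_iff₀ (by positivity)] at h3
  linarith

/-- Candidacy is a condition on single points, so the candidates are the finite subsets of the set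
of heavy grid points. An infinite such set would contain arbitrarily large candidates. -/
theorem exists_finset_isCandidate_iff (hk : 1 ≤ k) (hε : 0 < ε) (hσ : 0 < σ) (hI : I.Nonempty)
    (x : Fin m → ℝ) :
    ∃ W : Finset ℤ, (W.card : ℝ) ≤ 2 * k * (4 * (σ / ε) + 1) ∧
      ∀ A, IsCandidate k ε σ I x A ↔ A ⊆ W := by
  set W : Set ℤ := {n | (I.card : ℝ) / (2 * k) ≤ ∑ j ∈ I, window σ (ε * n) (x j)} with hW
  have hfin : W.Finite := by
    by_contra hinf
    obtain ⟨M, hM⟩ := exists_nat_gt (2 * k * (4 * (σ / ε) + 1))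
    obtain ⟨A, hAW, hA⟩ := Set.Infinite.exists_subset_card_eq hinf M
    have hc : IsCandidate k ε σ I x A := fun n hn => hAW hn
    have := hc.card_le hk hε hσ hI
    rw [hA] at this
    linarith
  have hiff : ∀ A, IsCandidate k ε σ I x A ↔ A ⊆ hfin.toFinset := fun A => by
    constructor
    · exact fun h n hn => hfin.mem_toFinset.2 (h n hn)
    · exact fun h n hn => hfin.mem_toFinset.1 (h hn)
  exact ⟨hfin.toFinset, ((hiff _).2 subset_rfl).card_le hk hε hσ hI, hiff⟩

theorem encard_candidate_pairs_le (hk : 1 ≤ k) (hε : 0 < ε) (hσ : 0 < σ) (hI : I.Nonempty)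
    (x : Fin m → ℝ) :
    (({p : Finset ℤ × Finset ℤ | IsCandidate k ε σ I x p.1 ∧ IsCandidate k ε σ I x p.2}.encard :
      ℕ∞) : ℝ≥0∞) ≤ ENNReal.ofReal (Real.exp (4 * k * (4 * (σ / ε) + 1))) := by
  obtain ⟨W, hWc, hW⟩ := exists_finset_isCandidate_iff hk hε hσ hI x
  have h1 : {p : Finset ℤ × Finset ℤ | IsCandidate k ε σ I x p.1 ∧ IsCandidate k ε σ I x p.2} =
      ((W.powerset ×ˢ W.powerset : Finset (Finset ℤ × Finset ℤ)) : Set (Finset ℤ × Finset ℤ)) := by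
    ext p
    simp [hW]
  rw [h1, Set.encard_coe_eq_coe_finsetCard, Finset.card_product, Finset.card_powerset]
  have h2 : ((2 ^ W.card * 2 ^ W.card : ℕ) : ℝ) ≤ Real.exp (4 * k * (4 * (σ / ε) + 1)) := by
    have h3 : (2 : ℝ) ≤ Real.exp 1 := by linarith [Real.add_one_le_exp 1]
    calc ((2 ^ W.card * 2 ^ W.card : ℕ) : ℝ) = 2 ^ (2 * W.card) := by push_cast; ring
      _ ≤ Real.exp 1 ^ (2 * W.card) := by gcongr
      _ = Real.exp (2 * W.card) := by rw [← Real.exp_nat_mul]; push_cast; ring_nf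
      _ ≤ _ := Real.exp_le_exp.2 (by linarith)
  calc (((2 ^ W.card * 2 ^ W.card : ℕ) : ℕ∞) : ℝ≥0∞) = ((2 ^ W.card * 2 ^ W.card : ℕ) : ℝ≥0∞) := by
        simp
    _ = ENNReal.ofReal ((2 ^ W.card * 2 ^ W.card : ℕ) : ℝ) := (ENNReal.ofReal_natCast _).symm
    _ ≤ _ := ENNReal.ofReal_le_ofReal h2

theorem measurableSet_comap_isCandidate (A : Finset ℤ) :
    MeasurableSet[MeasurableSpace.comap (fun (x : Fin m → ℝ) (j : I) => x j) inferInstance]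
      {x | IsCandidate k ε σ I x A} := by
  have : {x | IsCandidate k ε σ I x A} = ⋂ n ∈ A,
      {x : Fin m → ℝ | (I.card : ℝ) / (2 * k) ≤ ∑ j ∈ I, window σ (ε * n) (x j)} := by
    ext x
    simp [IsCandidate]
  rw [this]
  exact Finset.measurableSet_biInter A fun n _ =>
    measurableSet_le measurable_const (measurable_comap_sum I (measurable_window σ _))

theorem comap_samples_le (s : Finset (Fin m)) :
    MeasurableSpace.comap (fun (x : Fin m → ℝ) (j : s) => x j) inferInstance ≤
      (inferInstance : MeasurableSpace (Fin m → ℝ)) :=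
  Measurable.comap_le (measurable_pi_lambda _ fun _ => measurable_pi_apply _)

theorem measurableSet_isCandidate (A : Finset ℤ) :
    MeasurableSet {x : Fin m → ℝ | IsCandidate k ε σ I x A} :=
  comap_samples_le I _ (measurableSet_comap_isCandidate A)

theorem measurableSet_comap_le_norm_empiricalCharFun (t r : ℝ) (z : ℂ) :
    MeasurableSet[MeasurableSpace.comap (fun (x : Fin m → ℝ) (j : J) => x j) inferInstance]
      {x | r ≤ ‖empiricalCharFun J x t - z‖} := by
  have h := measurable_comap_sum J (g := fun y : ℝ => Complex.exp (t * y * Complex.I))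
    (by fun_prop)
  have h2 : Measurable fun w : ℂ => ‖(J.card : ℂ)⁻¹ * w - z‖ := by fun_prop
  exact measurableSet_le measurable_const (h2.comp h)

/-- The true set of mean indices is a candidate with high probability. -/
theorem measure_not_isCandidate_le {ν : Fin k → ℤ} (hk : 1 ≤ k) (hσ : 0 < σ) [NeZero k] :
    (sampleLaw (fun i => ε * ν i) σ m).real
      {x | ¬ IsCandidate k ε σ I x (Finset.univ.image ν)} ≤
      2 * k * Real.exp (-(I.card / (32 * k ^ 2))) := by
  have hk' : (0 : ℝ) < k := by exact_mod_cast hk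
  have hsub : {x | ¬ IsCandidate k ε σ I x (Finset.univ.image ν)} ⊆
      ⋃ i : Fin k, {x : Fin m → ℝ | I.card * (1 / (4 * k) : ℝ) ≤
        |∑ j ∈ I, window σ (ε * ν i) (x j) -
          I.card * ∫ y, window σ (ε * ν i) y ∂mixture (fun i => ε * ν i) σ|} := by
    intro x hx
    simp only [Set.mem_ofPred_eq, IsCandidate, not_forall, not_le] at hx
    obtain ⟨n, hn, hlt⟩ := hx
    obtain ⟨i, -, rfl⟩ := Finset.mem_image.1 hn
    refine Set.mem_iUnion.2 ⟨i, ?_⟩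
    -- The expected fraction is at least `3/(4k)` and the threshold is `1/(2k)`, so failure means a
    -- deviation of at least `1/(4k)`.
    have h1 := integral_window_ge (fun i => ε * (ν i : ℝ)) hσ i
    have h2 : (I.card : ℝ) * (3 / (4 * k)) ≤
        I.card * ∫ y, window σ (ε * ν i) y ∂mixture (fun i => ε * ν i) σ := by gcongr
    have h3 : (I.card : ℝ) * (3 / (4 * k)) = I.card / (2 * k) + I.card * (1 / (4 * k)) := by
      field_simp; ring
    rw [Set.mem_ofPred_eq, le_abs]
    right
    linarith
  refine (measureReal_mono hsub).trans ((measureReal_iUnion_fintype_le _).trans ?_)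
  have hterm : ∀ i : Fin k, (sampleLaw (fun i => ε * (ν i : ℝ)) σ m).real
      {x : Fin m → ℝ | I.card * (1 / (4 * k) : ℝ) ≤
        |∑ j ∈ I, window σ (ε * ν i) (x j) -
          I.card * ∫ y, window σ (ε * ν i) y ∂mixture (fun i => ε * ν i) σ|} ≤
      2 * Real.exp (-(I.card / (32 * k ^ 2))) := by
    intro i
    have h := measure_abs_sum_sub_ge_le (ν := mixture (fun i => ε * ν i) σ)
      (measurable_window σ (ε * ν i))
      (fun y => ⟨by linarith [window_nonneg σ (ε * ν i) y], window_le_one _ _ _⟩) I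
      (r := 1 / (4 * k)) (by positivity)
    have h2 : (I.card : ℝ) * (1 / (4 * k)) ^ 2 / 2 = I.card / (32 * k ^ 2) := by
      field_simp; ring
    rwa [h2] at h
  refine (Finset.sum_le_sum fun i _ => hterm i).trans_eq ?_
  rw [Finset.sum_const, Finset.card_univ, Fintype.card_fin, nsmul_eq_mul]
  ring

/-- `A` is a candidate whose characteristic function agrees with the empirical one at all the
frequencies that separate pairs of candidates. -/
def IsSelected (k : ℕ) (ε σ η : ℝ) (τ : Finset ℤ → Finset ℤ → ℝ) (I J : Finset (Fin m))
    (x : Fin m → ℝ) (A : Finset ℤ) : Prop :=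
  IsCandidate k ε σ I x A ∧ ∀ p : Finset ℤ × Finset ℤ,
    IsCandidate k ε σ I x p.1 ∧ IsCandidate k ε σ I x p.2 →
      ‖empiricalCharFun J x (τ p.1 p.2) - gridCharFun k ε σ A (τ p.1 p.2)‖ < η / 2

variable {η : ℝ} {τ : Finset ℤ → Finset ℤ → ℝ}

/-- Both characteristic functions would lie within `η/2` of the empirical one at the frequency that
separates them by `η`. -/
theorem IsSelected.unique
    (hτ : ∀ A B, A ≠ B → η ≤ ‖gridCharFun k ε σ A (τ A B) - gridCharFun k ε σ B (τ A B)‖)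
    {B : Finset ℤ} (hA : IsSelected k ε σ η τ I J x A) (hB : IsSelected k ε σ η τ I J x B) :
    A = B := by
  by_contra hne
  have h1 := hA.2 (A, B) ⟨hA.1, hB.1⟩
  have h2 := hB.2 (A, B) ⟨hA.1, hB.1⟩
  have h3 := norm_sub_le_norm_sub_add_norm_sub (gridCharFun k ε σ A (τ A B))
    (empiricalCharFun J x (τ A B)) (gridCharFun k ε σ B (τ A B))
  rw [norm_sub_rev (gridCharFun k ε σ A (τ A B)) (empiricalCharFun J x (τ A B))] at h3
  linarith [hτ A B hne]

theorem measurableSet_isSelected (A : Finset ℤ) :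
    MeasurableSet {x : Fin m → ℝ | IsSelected k ε σ η τ I J x A} := by
  have : {x : Fin m → ℝ | IsSelected k ε σ η τ I J x A} =
      {x | IsCandidate k ε σ I x A} ∩ ⋂ p : Finset ℤ × Finset ℤ,
        (({x | IsCandidate k ε σ I x p.1} ∩ {x | IsCandidate k ε σ I x p.2}) ∩
          {x | η / 2 ≤
            ‖empiricalCharFun J x (τ p.1 p.2) - gridCharFun k ε σ A (τ p.1 p.2)‖})ᶜ := by
    ext x
    simp [IsSelected]
  rw [this]
  refine (measurableSet_isCandidate A).inter (MeasurableSet.iInter fun p => ?_)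
  exact (((measurableSet_isCandidate _).inter (measurableSet_isCandidate _)).inter
    (comap_samples_le J _ (measurableSet_comap_le_norm_empiricalCharFun _ _ _))).compl

/-- The true set of mean indices is selected with high probability. -/
theorem measure_not_isSelected_le {ν : Fin k → ℤ} (hν : Function.Injective ν) (hk : 1 ≤ k)
    (hε : 0 < ε) (hσ : 0 < σ) (hη : 0 < η) (hI : I.Nonempty) (hJ : J.Nonempty)
    (hIJ : Disjoint I J) [NeZero k] :
    sampleLaw (fun i => ε * ν i) σ m
      {x | ¬ IsSelected k ε σ η τ I J x (Finset.univ.image ν)} ≤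
      ENNReal.ofReal (2 * k * Real.exp (-(I.card / (32 * k ^ 2))) +
        Real.exp (4 * k * (4 * (σ / ε) + 1)) * (4 * Real.exp (-(J.card * η ^ 2 / 32)))) := by
  set P := sampleLaw (fun i => ε * (ν i : ℝ)) σ m with hP
  set A := Finset.univ.image ν with hA
  set E : Finset ℤ × Finset ℤ → Set (Fin m → ℝ) := fun p =>
    {x | IsCandidate k ε σ I x p.1} ∩ {x | IsCandidate k ε σ I x p.2} with hE
  set B : Finset ℤ × Finset ℤ → Set (Fin m → ℝ) := fun p =>
    {x | η / 2 ≤ ‖empiricalCharFun J x (τ p.1 p.2) - gridCharFun k ε σ A (τ p.1 p.2)‖} with hB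
  have hsub : {x | ¬ IsSelected k ε σ η τ I J x A} ⊆
      {x | ¬ IsCandidate k ε σ I x A} ∪ ⋃ p, E p ∩ B p := by
    intro x hx
    by_cases hc : IsCandidate k ε σ I x A
    · right
      simp only [Set.mem_ofPred_eq, IsSelected, hc, true_and, not_forall, not_lt] at hx
      obtain ⟨p, hp, hp'⟩ := hx
      exact Set.mem_iUnion.2 ⟨p, hp, hp'⟩
    · exact Or.inl hc
  have h1 : P {x | ¬ IsCandidate k ε σ I x A} ≤
      ENNReal.ofReal (2 * k * Real.exp (-(I.card / (32 * k ^ 2)))) := by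
    rw [← ofReal_measureReal]
    exact ENNReal.ofReal_le_ofReal (measure_not_isCandidate_le hk hσ)
  have h2 : P (⋃ p, E p ∩ B p) ≤ ENNReal.ofReal (Real.exp (4 * k * (4 * (σ / ε) + 1))) *
      ENNReal.ofReal (4 * Real.exp (-(J.card * η ^ 2 / 32))) := by
    refine measure_iUnion_inter_le P
      (fun p => (measurableSet_isCandidate _).inter (measurableSet_isCandidate _)) (fun p => ?_)
      (encard_candidate_pairs_le hk hε hσ hI)
    have hBp : P (B p) ≤ ENNReal.ofReal (4 * Real.exp (-(J.card * η ^ 2 / 32))) := by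
      rw [← ofReal_measureReal]
      refine ENNReal.ofReal_le_ofReal ?_
      have h := measure_norm_empiricalCharFun_sub_ge_le (ν := mixture (fun i => ε * ν i) σ) hJ
        (τ p.1 p.2) (r := η / 2) (by positivity)
      rw [charFun_mixture hν, show J.card * (η / 2) ^ 2 / 8 = J.card * η ^ 2 / 32 by ring] at h
      exact h
    -- Candidacy depends on the samples in `I`, the deviation on those in `J`.
    have hEB : P (E p ∩ B p) = P (E p) * P (B p) :=
      measure_inter_of_disjoint hIJ
        (MeasurableSet.inter (measurableSet_comap_isCandidate _)
          (measurableSet_comap_isCandidate _))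
        (measurableSet_comap_le_norm_empiricalCharFun _ _ _)
    rw [hEB]
    gcongr
  calc P {x | ¬ IsSelected k ε σ η τ I J x A} ≤ _ := measure_mono hsub
    _ ≤ _ := measure_union_le _ _
    _ ≤ _ := add_le_add h1 h2
    _ = _ := by
      rw [← ENNReal.ofReal_mul (Real.exp_pos _).le,
        ← ENNReal.ofReal_add (by positivity) (by positivity)]

/-- The set of means with indices in the selected set, if there is one. -/
def estimator (k : ℕ) (ε σ η : ℝ) (τ : Finset ℤ → Finset ℤ → ℝ) (I J : Finset (Fin m))
    (x : Fin m → ℝ) : Finset ℝ :=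
  open scoped Classical in
  if h : ∃ A, IsSelected k ε σ η τ I J x A then h.choose.image fun n : ℤ => ε * n else ∅

theorem estimator_eq
    (hτ : ∀ A B, A ≠ B → η ≤ ‖gridCharFun k ε σ A (τ A B) - gridCharFun k ε σ B (τ A B)‖)
    (hA : IsSelected k ε σ η τ I J x A) :
    open scoped Classical in
    estimator k ε σ η τ I J x = A.image fun n : ℤ => ε * n := by
  have h : ∃ A, IsSelected k ε σ η τ I J x A := ⟨A, hA⟩
  rw [estimator, dif_pos h, IsSelected.unique hτ h.choose_spec hA]

/-- Uniqueness makes the choice in `estimator` immaterial, so preimages are built from countably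
many selection events. -/
theorem measurable_estimator
    (hτ : ∀ A B, A ≠ B → η ≤ ‖gridCharFun k ε σ A (τ A B) - gridCharFun k ε σ B (τ A B)‖) :
    Measurable[_, ⊤] (estimator k ε σ η τ I J) := by
  classical
  intro s _
  have hset : estimator k ε σ η τ I J ⁻¹' s =
      (⋃ A ∈ {A : Finset ℤ | (A.image fun n : ℤ => ε * n) ∈ s},
        {x | IsSelected k ε σ η τ I J x A}) ∪
      ((⋃ A, {x | IsSelected k ε σ η τ I J x A})ᶜ ∩ {_x | ∅ ∈ s}) := by
    ext x
    by_cases h : ∃ A, IsSelected k ε σ η τ I J x A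
    · obtain ⟨A, hA⟩ := h
      have h1 : ∀ B, IsSelected k ε σ η τ I J x B ↔ B = A := fun B =>
        ⟨fun hB => hB.unique hτ hA, fun hB => hB ▸ hA⟩
      simp only [Set.mem_preimage, estimator_eq hτ hA]
      simp only [Set.mem_union, Set.mem_iUnion, Set.mem_inter_iff, Set.mem_compl_iff,
        Set.mem_ofPred_eq, h1]
      simp only [exists_prop, exists_eq_right, exists_eq, not_true_eq_false, false_and, or_false]
    · have h1 : ∀ B, ¬ IsSelected k ε σ η τ I J x B := fun B hB => h ⟨B, hB⟩
      simp only [Set.mem_preimage, estimator, dif_neg h]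
      simp [h1]
  rw [hset]
  exact (MeasurableSet.biUnion (Set.to_countable _) fun A _ => measurableSet_isSelected A).union
    ((MeasurableSet.iUnion fun A => measurableSet_isSelected A).compl.inter (MeasurableSet.const _))

end Candidates

/-! ### Assembly and numerical constants -/

section Main

theorem meanSet_eq_image {k : ℕ} (ε : ℝ) (ν : Fin k → ℤ) :
    open scoped Classical in
    meanSet (fun i => ε * (ν i : ℝ)) = (Finset.univ.image ν).image fun n : ℤ => ε * n := by
  ext y
  simp [meanSet]

/-- The estimator built from a splitting of the samples into two groups. -/
theorem exists_identifiesMeans {k m : ℕ} {ε σ δ : ℝ} (hk : 1 ≤ k) (hε : 0 < ε) (hσ : 0 < σ)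
    {I J : Finset (Fin m)} (hI : I.Nonempty) (hJ : J.Nonempty) (hIJ : Disjoint I J) {η : ℝ}
    (hη : η = (k : ℝ)⁻¹ * Real.exp (-(33 * (1 + (σ / ε) ^ ((2 : ℝ) / 3)))))
    (hδ : 2 * k * Real.exp (-(I.card / (32 * k ^ 2))) +
      Real.exp (4 * k * (4 * (σ / ε) + 1)) * (4 * Real.exp (-(J.card * η ^ 2 / 32))) ≤ δ) :
    ∃ est : (Fin m → ℝ) → Finset ℝ, IdentifiesMeans k ε σ δ m est := by
  have : NeZero k := ⟨by omega⟩
  have hη0 : 0 < η := by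
    have : (0 : ℝ) < k := by exact_mod_cast hk
    rw [hη]; positivity
  have hex : ∀ A B : Finset ℤ, ∃ t : ℝ, A ≠ B →
      η ≤ ‖gridCharFun k ε σ A t - gridCharFun k ε σ B t‖ := fun A B => by
    by_cases h : A = B
    -- A dummy frequency on the diagonal; the failure bound holds for every `τ`.
    · exact ⟨0, fun h' => absurd h h'⟩
    · obtain ⟨t, ht⟩ := exists_norm_gridCharFun_sub_ge hk hε hσ h
      exact ⟨t, fun _ => hη ▸ ht⟩
  choose τ hτ using hex
  refine ⟨estimator k ε σ η τ I J, measurable_estimator hτ, ?_⟩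
  rintro μ ⟨hinj, hgrid⟩
  choose ν hν using hgrid
  obtain rfl : μ = fun i => ε * (ν i : ℝ) := funext hν
  have hνinj : Function.Injective ν := fun i j hij => hinj (by simp [hij])
  set S := {x : Fin m → ℝ | IsSelected k ε σ η τ I J x (Finset.univ.image ν)} with hS
  have hbad := measure_not_isSelected_le (τ := τ) hνinj hk hε hσ hη0 hI hJ hIJ
  have hsub : S ⊆ {x | estimator k ε σ η τ I J x = meanSet fun i => ε * (ν i : ℝ)} := by
    intro x hx
    rw [Set.mem_ofPred_eq, meanSet_eq_image]
    exact estimator_eq hτ hx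
  refine le_trans ?_ (measure_mono hsub)
  have hSm : MeasurableSet S := measurableSet_isSelected _
  have hle : sampleLaw (fun i => ε * (ν i : ℝ)) σ m Sᶜ ≤ ENNReal.ofReal δ :=
    hbad.trans (ENNReal.ofReal_le_ofReal hδ)
  have hδ0 : 0 ≤ δ := le_trans (by positivity) hδ
  have hadd := prob_add_prob_compl (μ := sampleLaw (fun i => ε * (ν i : ℝ)) σ m) hSm
  rw [ENNReal.ofReal_sub _ hδ0, ENNReal.ofReal_one, tsub_le_iff_right, ← hadd]
  gcongr

/-- Each of the two failure terms is at most `δ/2`. In the constant, `96 = 3 · 32` pays for the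
third of the samples and the Hoeffding denominators, and `exp 66 · exp (66 x)` cancels the
exponential in `η²`. One further `exp x` absorbs `ρ = x^(3/2)`, whence 67. -/
theorem failure_bound {k : ℕ} (hk : 1 ≤ k) {ρ δ x c₁ c₂ s η : ℝ} (hρ : 0 < ρ) (hδ : 0 < δ)
    (hδ1 : δ < 1) (hx : x = ρ ^ ((2 : ℝ) / 3))
    (hη : η = (k : ℝ)⁻¹ * Real.exp (-(33 * (1 + x))))
    (hs : s = 96 * 39 * Real.exp 66 * ((k : ℝ) ^ 3 + k ^ 2 * Real.log (1 / δ)) *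
      Real.exp (67 * x))
    (h₁ : s / 3 ≤ c₁) (h₂ : s / 3 ≤ c₂) :
    2 * k * Real.exp (-(c₁ / (32 * k ^ 2))) +
      Real.exp (4 * k * (4 * ρ + 1)) * (4 * Real.exp (-(c₂ * η ^ 2 / 32))) ≤ δ := by
  have hk1 : (1 : ℝ) ≤ k := by exact_mod_cast hk
  have hk0 : (0 : ℝ) < k := by linarith
  have hL : 0 < Real.log (1 / δ) := Real.log_pos (by rw [lt_div_iff₀ hδ]; linarith)
  set L := Real.log (1 / δ) with hLdef
  have hexpL : Real.exp (-L) = δ := by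
    rw [hLdef, one_div, Real.log_inv, neg_neg, Real.exp_log hδ]
  have hx0 : 0 < x := by rw [hx]; positivity
  have hx3 : x ^ 3 = ρ ^ 2 := by
    rw [hx, ← Real.rpow_natCast, ← Real.rpow_natCast, ← Real.rpow_mul hρ.le]
    norm_num
  have hρx : ρ ≤ 2 * Real.exp x := by
    have h1 : ρ ≤ 1 + x ^ 2 := by
      refine le_of_sq_le_sq ?_ (by positivity)
      rw [← hx3]
      nlinarith [sq_nonneg (x * (x - 1)), sq_nonneg x]
    linarith [Real.quadratic_le_exp_of_nonneg hx0.le]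
  have hsk : s = (k ^ 2 * (k + L)) * (96 * 39 * Real.exp 66 * Real.exp (67 * x)) := by
    rw [hs]; ring
  have h66 : 1 ≤ Real.exp 66 := Real.one_le_exp (by norm_num)
  have h67 : 1 ≤ Real.exp (67 * x) := Real.one_le_exp (by positivity)
  have hu : 3 * k + L ≤ c₁ / (32 * k ^ 2) := by
    have h3 : 3 * k + L ≤ s / 3 / (32 * k ^ 2) := by
      have : s / 3 / (32 * k ^ 2) = (k + L) * (39 * (Real.exp 66 * Real.exp (67 * x))) := by
        rw [hsk]; field_simp; ring
      rw [this]
      nlinarith [one_le_mul_of_one_le_of_one_le h66 h67]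
    exact h3.trans (by gcongr)
  have hv : 4 * k * (4 * ρ + 1) + 3 + L ≤ c₂ * η ^ 2 / 32 := by
    have h3 : s / 3 * η ^ 2 / 32 = (k + L) * (39 * Real.exp x) := by
      have h4 : η ^ 2 = (k : ℝ)⁻¹ ^ 2 * Real.exp (-(66 * (1 + x))) := by
        rw [hη, mul_pow, ← Real.exp_nat_mul]
        congr 2
        push_cast
        ring
      have h5 : Real.exp x = Real.exp 66 * Real.exp (67 * x) * Real.exp (-(66 * (1 + x))) := by
        rw [← Real.exp_add, ← Real.exp_add]
        congr 1
        ring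
      rw [h4, hsk, h5]
      field_simp
      ring
    -- From `ρ ≤ 2 exp x`, the terms are at most `32`, `4` and `3` times `k exp x`, which gives 39.
    have h4 : 4 * k * (4 * ρ + 1) + 3 + L ≤ s / 3 * η ^ 2 / 32 := by
      rw [h3]
      have h5 : 1 ≤ Real.exp x := Real.one_le_exp hx0.le
      have h6 : k * ρ ≤ k * (2 * Real.exp x) := by gcongr
      have h7 : (k : ℝ) ≤ k * Real.exp x := le_mul_of_one_le_right hk0.le h5
      have h8 : L ≤ L * Real.exp x := le_mul_of_one_le_right hL.le h5
      nlinarith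
    exact h4.trans (by gcongr)
  have hA : 2 * k * Real.exp (-(c₁ / (32 * k ^ 2))) ≤ δ / 2 := by
    have h1 : Real.exp (-(c₁ / (32 * k ^ 2))) ≤ Real.exp (-(3 * k)) * δ := by
      rw [← hexpL, ← Real.exp_add]
      exact Real.exp_le_exp.2 (by linarith)
    have h2 : 4 * k * Real.exp (-(3 * k)) ≤ 1 := by
      rw [Real.exp_neg, ← div_eq_mul_inv, div_le_one (Real.exp_pos _)]
      have := Real.quadratic_le_exp_of_nonneg (x := 3 * k) (by positivity)
      nlinarith
    have h3 : 2 * k * Real.exp (-(c₁ / (32 * k ^ 2))) ≤ 2 * k * (Real.exp (-(3 * k)) * δ) := by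
      gcongr
    nlinarith
  have hB : Real.exp (4 * k * (4 * ρ + 1)) * (4 * Real.exp (-(c₂ * η ^ 2 / 32))) ≤ δ / 2 := by
    have h1 : Real.exp (-(c₂ * η ^ 2 / 32)) ≤
        Real.exp (-(4 * k * (4 * ρ + 1))) * (Real.exp (-3) * δ) := by
      rw [← hexpL, ← Real.exp_add, ← Real.exp_add]
      exact Real.exp_le_exp.2 (by linarith)
    have h2 : Real.exp (-3) ≤ 1 / 8 := by
      rw [Real.exp_neg, one_div]
      refine inv_anti₀ (by norm_num) ?_
      linarith [Real.quadratic_le_exp_of_nonneg (x := 3) (by norm_num)]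
    calc _ ≤ Real.exp (4 * k * (4 * ρ + 1)) *
          (4 * (Real.exp (-(4 * k * (4 * ρ + 1))) * (Real.exp (-3) * δ))) := by gcongr
      _ = 4 * Real.exp (-3) * δ := by
        rw [Real.exp_neg (4 * k * (4 * ρ + 1))]; field_simp
      _ ≤ δ / 2 := by nlinarith
  linarith

end Main

end GaussianMixture

end

theorem theorem1 :
    ∃ C : ℝ, 0 < C ∧
      ∀ (k : ℕ) (ε σ δ : ℝ), 1 ≤ k → 0 < ε → 0 < σ → 0 < δ → δ < 1 →
        ∀ m : ℕ,
          C * ((k : ℝ) ^ 3 + (k : ℝ) ^ 2 * Real.log (1 / δ)) *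
              Real.exp (C * (σ / ε) ^ ((2 : ℝ) / 3)) ≤ (m : ℝ) →
            ∃ est : (Fin m → ℝ) → Finset ℝ,
              GaussianMixture.IdentifiesMeans k ε σ δ m est := by
  have h66 : 1 ≤ Real.exp 66 := Real.one_le_exp (by norm_num)
  refine ⟨96 * 39 * Real.exp 66, by positivity, fun k ε σ δ hk hε hσ hδ hδ1 m hm => ?_⟩
  set x := (σ / ε) ^ ((2 : ℝ) / 3) with hx
  have hk1 : (1 : ℝ) ≤ k := by exact_mod_cast hk
  have hx0 : 0 < x := by positivity
  have hL : 0 < Real.log (1 / δ) := Real.log_pos (by rw [lt_div_iff₀ hδ]; linarith)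
  set s := 96 * 39 * Real.exp 66 * ((k : ℝ) ^ 3 + k ^ 2 * Real.log (1 / δ)) *
    Real.exp (67 * x) with hs
  -- The single constant `C` also serves in the exponent, where only `67 ≤ C` is needed.
  have hsm : s ≤ m := by
    refine le_trans ?_ hm
    rw [hs]
    gcongr
    linarith
  have hm2 : 2 ≤ m := by
    have h1 : 1 ≤ (k : ℝ) ^ 3 + k ^ 2 * Real.log (1 / δ) := by
      have : 1 ≤ (k : ℝ) ^ 3 := one_le_pow₀ hk1
      have : 0 < (k : ℝ) ^ 2 * Real.log (1 / δ) := by positivity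
      linarith
    have h2 : 1 ≤ Real.exp (67 * x) := Real.one_le_exp (by positivity)
    have h3 : 2 ≤ s := by
      rw [hs]
      calc (2 : ℝ) ≤ 96 * 39 * 1 * 1 * 1 := by norm_num
        _ ≤ _ := by gcongr
    exact_mod_cast h3.trans hsm
  -- Since `m ≥ 2`, both halves are nonempty and contain at least `m/3` samples despite the
  -- rounding.
  obtain ⟨I, -, hI⟩ := Finset.exists_subset_card_eq
    (s := (Finset.univ : Finset (Fin m))) (n := m / 2) (by simp; omega)
  have hJ : Iᶜ.card = m - m / 2 := by rw [Finset.card_compl, hI, Fintype.card_fin]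
  have hthird : ∀ n : ℕ, m ≤ 3 * n → s / 3 ≤ n := fun n hn => by
    have : (m : ℝ) ≤ 3 * n := by exact_mod_cast hn
    linarith
  exact GaussianMixture.exists_identifiesMeans hk hε hσ (I := I) (J := Iᶜ)
    (Finset.card_pos.1 (by omega)) (Finset.card_pos.1 (by omega)) disjoint_compl_right rfl
    (GaussianMixture.failure_bound hk (div_pos hσ hε) hδ hδ1 hx rfl hs (hthird _ (by omega))
      (hthird _ (by omega)))
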